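/- Let $\mathcal C$ be a rigid, semisimple C*-tensor category (closed under finite direct sums and subobjects) with simple unit object $\mathbbm 1$. Let $\mathbf{Irr}$ be a set of representatives of the isomorphism classes of simple objects; for $w\in\mathbf{Irr}$ let $\bar w\in\mathbf{Irr}$ be its conjugate, $(R_w,\bar R_w)$ a standard solution of the conjugate equations for $(w,\bar w)$, and $d(w)=R_w^*R_w>0$ its categorical dimension. For objects $x,y$ put $$\mathcal A_{x,y}=\bigoplus_{w\in\mathbf{Irr}}\mathcal C(w\otimes x,\,y\otimes w).$$ For an object $z$ and $\gamma\in\mathcal C(z\otimes x,y\otimes z)$ let $\Psi^z_{x,y}(\gamma)\in\mathcal A_{x,y}$ be the element with components $\sum_{V}(1_y\otimes V^*)\,\gamma\,(V\otimes 1_x)$, $w\in\mathbf{Irr}$, where $V$ runs over an orthonormal basis of $\mathcal C(w,z)$ for the inner product $\langle\sigma,\tau\rangle 1_w=\tau^*\sigma$. The tube algebra multiplication $\mathcal A_{s,j}\times\mathcal A_{i,s}\to\mathcal A_{i,j}$ and involution $\mathcal A_{x,y}\to\mathcal A_{y,x}$ are $$a\cdot b=\sum_{m,l\in\mathbf{Irr}}\Psi^{m\otimes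 l}_{i,j}\big((a^m\otimes 1_l)(1_m\otimes b^l)\big),\qquad (a^*)^k=(\bar R_k^*\otimes 1_x\otimes 1_k)\,(1_k\otimes (a^{\bar k})^*\otimes 1_k)\,(1_k\otimes 1_y\otimes R_k).$$ The fusion algebra $\mathbb C[\mathcal C]$, the complex vector space with basis $\mathbf{Irr}$, is identified with the $*$-algebra $\mathcal A_{\mathbbm 1,\mathbbm 1}$ by sending $w\in\mathbf{Irr}$ to $1_w\in\mathcal C(w\otimes\mathbbm 1,\mathbbm 1\otimes w)$. The tube cone is $$\Sigma^2\mathcal C=\Big\{\sum_{i=1}^n a_i a_i^* : n\in\mathbb N,\ x_i\in\mathbf{Irr},\ a_i\in\mathcal A_{x_i,\mathbbm 1}\Big\}\subset\mathbb C[\mathcal C].$$ **Proposition.** Let $S\subset\mathbf{Irr}$ be a finite set that is symmetric ($\alpha\in S$ if and only if $\bar\alpha\in S$) and generating (every $w\in\mathbf{Irr}$ is a subobject of $s_1\otimes\cdots\otimes s_n$ for some $n\ge 1$ and $s_1,\dots,s_n\in S$), and let $\nu:S\to(0,\infty)$ satisfy $\nu(\alpha)=\nu(\bar\alpha)$ for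 all $\alpha\in S$. Then the Laplacian $$\Delta=\mathbbm 1-\frac1\kappa\sum_{\alpha\in S}\nu(\alpha)\,\alpha\in\mathbb C[\mathcal C],\qquad \kappa=\sum_{\alpha\in S}\nu(\alpha)\,d(\alpha),$$ is positive with respect to the tube cone, that is, $\Delta\in\Sigma^2\mathcal C$. -/

import Mathlib

open CategoryTheory MonoidalCategory
open scoped ComplexConjugate

universe v u

/-- A C*-category structure on a `ℂ`-linear category: a conjugate linear contravariant involution
`dag` that is the identity on objects, and complete norms on the morphism spaces that are
submultiplicative and satisfy the C*-identity, such that `f* f` is a positive element of the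
C*-algebra `End X` (that is, `f* f = g* g` with `g ∈ End X`) for every `f : X ⟶ Y`.
Composition is written diagrammatically: `f* f` is `f ≫ dag f`. -/
class CStarCat (C : Type u) [Category.{v} C] [Preadditive C] [Linear ℂ C] where
  dag : ∀ {X Y : C}, (X ⟶ Y) → (Y ⟶ X)
  dag_dag : ∀ {X Y : C} (f : X ⟶ Y), dag (dag f) = f
  dag_comp : ∀ {X Y Z : C} (f : X ⟶ Y) (g : Y ⟶ Z), dag (f ≫ g) = dag g ≫ dag f
  dag_add : ∀ {X Y : C} (f g : X ⟶ Y), dag (f + g) = dag f + dag g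
  dag_smul : ∀ {X Y : C} (c : ℂ) (f : X ⟶ Y), dag (c • f) = conj c • dag f
  norm : ∀ {X Y : C}, (X ⟶ Y) → ℝ
  norm_nonneg : ∀ {X Y : C} (f : X ⟶ Y), 0 ≤ norm f
  norm_eq_zero : ∀ {X Y : C} (f : X ⟶ Y), norm f = 0 ↔ f = 0
  norm_smul : ∀ {X Y : C} (c : ℂ) (f : X ⟶ Y), norm (c • f) = ‖c‖ * norm f
  norm_add_le : ∀ {X Y : C} (f g : X ⟶ Y), norm (f + g) ≤ norm f + norm g
  norm_comp_le : ∀ {X Y Z : C} (f : X ⟶ Y) (g : Y ⟶ Z), norm (f ≫ g) ≤ norm f * norm g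
  complete : ∀ {X Y : C} (a : ℕ → (X ⟶ Y)),
    (∀ ε : ℝ, 0 < ε → ∃ N, ∀ m n, N ≤ m → N ≤ n → norm (a m - a n) < ε) →
    ∃ l : X ⟶ Y, ∀ ε : ℝ, 0 < ε → ∃ N, ∀ n, N ≤ n → norm (a n - l) < ε
  norm_comp_dag : ∀ {X Y : C} (f : X ⟶ Y), norm (f ≫ dag f) = norm f ^ 2
  comp_dag_pos : ∀ {X Y : C} (f : X ⟶ Y), ∃ g : X ⟶ X, f ≫ dag f = g ≫ dag g

open CStarCat (dag)

/-- A C*-tensor category (not necessarily strict): the tensor product is bilinear and compatible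
with the involution, the associator and the unitors are unitary, and the category is closed under
finite (orthogonal) direct sums and under subobjects (projections split). -/
class CStarTensorCat (C : Type u) [Category.{v} C] [Preadditive C] [Linear ℂ C]
    [MonoidalCategory C] [MonoidalPreadditive C] [MonoidalLinear ℂ C] [CStarCat C] : Prop where
  dag_whiskerLeft : ∀ (X : C) {Y Z : C} (f : Y ⟶ Z), dag (X ◁ f) = X ◁ dag f
  dag_whiskerRight : ∀ {X Y : C} (f : X ⟶ Y) (Z : C), dag (f ▷ Z) = dag f ▷ Z
  dag_associator : ∀ X Y Z : C, dag (α_ X Y Z).hom = (α_ X Y Z).inv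
  dag_leftUnitor : ∀ X : C, dag (λ_ X).hom = (λ_ X).inv
  dag_rightUnitor : ∀ X : C, dag (ρ_ X).hom = (ρ_ X).inv
  exists_directSum : ∀ X Y : C, ∃ (Z : C) (a : X ⟶ Z) (b : Y ⟶ Z),
    a ≫ dag a = 𝟙 X ∧ b ≫ dag b = 𝟙 Y ∧ dag a ≫ a + dag b ≫ b = 𝟙 Z
  exists_subobject : ∀ (X : C) (p : X ⟶ X), p ≫ p = p → dag p = p →
    ∃ (Y : C) (a : Y ⟶ X), a ≫ dag a = 𝟙 Y ∧ dag a ≫ a = p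

/-- A simple object of a C*-category: `End X = ℂ 1 ≠ 0`. -/
def IsSimpleObj {C : Type u} [Category.{v} C] [Preadditive C] [Linear ℂ C] (X : C) : Prop :=
  Module.finrank ℂ (X ⟶ X) = 1

/-- A solution `(R, R̄)` of the conjugate equations for the pair `(X, Y)`, `Y` in the role of the
conjugate of `X`: `(1 ⊗ R̄*)(R ⊗ 1) = 1_Y` and `(1 ⊗ R*)(R̄ ⊗ 1) = 1_X`. -/
structure ConjSolution {C : Type u} [Category.{v} C] [Preadditive C] [Linear ℂ C]
    [MonoidalCategory C] [CStarCat C] (X Y : C) where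
  R : 𝟙_ C ⟶ Y ⊗ X
  Rbar : 𝟙_ C ⟶ X ⊗ Y
  conj_eq : (λ_ Y).inv ≫ R ▷ Y ≫ (α_ Y X Y).hom ≫ Y ◁ dag Rbar ≫ (ρ_ Y).hom = 𝟙 Y
  conj_eq' : (λ_ X).inv ≫ Rbar ▷ X ≫ (α_ X Y X).hom ≫ X ◁ dag R ≫ (ρ_ X).hom = 𝟙 X

/-- Standard solutions: `R* (1 ⊗ f) R = R̄* (f ⊗ 1) R̄` for all `f ∈ End X`. -/
def ConjSolution.IsStandard {C : Type u} [Category.{v} C] [Preadditive C] [Linear ℂ C]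
    [MonoidalCategory C] [CStarCat C] {X Y : C} (s : ConjSolution X Y) : Prop :=
  ∀ f : X ⟶ X, s.R ≫ Y ◁ f ≫ dag s.R = s.Rbar ≫ f ▷ Y ≫ dag s.Rbar

/-- A rigid, semisimple C*-tensor category with simple unit object: every object has a conjugate,
and every object is a finite orthogonal direct sum of simple objects. -/
class RigidCStarTensorCat (C : Type u) [Category.{v} C] [Preadditive C] [Linear ℂ C]
    [MonoidalCategory C] [MonoidalPreadditive C] [MonoidalLinear ℂ C] [CStarCat C] : Prop
    extends CStarTensorCat C where
  exists_conj : ∀ X : C, ∃ Y : C, Nonempty (ConjSolution X Y)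
  semisimple : ∀ X : C, ∃ (n : ℕ) (s : Fin n → C) (a : ∀ i, s i ⟶ X),
    (∀ i, IsSimpleObj (s i)) ∧ (∀ i, a i ≫ dag (a i) = 𝟙 (s i)) ∧
    (∀ i j, i ≠ j → a i ≫ dag (a j) = 0) ∧ ∑ i, dag (a i) ≫ a i = 𝟙 X
  simple_unit : IsSimpleObj (𝟙_ C)

namespace CStarTensor

section Basic

variable {C : Type u} [Category.{v} C] [Preadditive C] [Linear ℂ C]

theorem IsSimpleObj.id_ne_zero {X : C} (h : IsSimpleObj X) : 𝟙 X ≠ 0 := by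
  intro h0
  have : Subsingleton (X ⟶ X) :=
    ⟨fun f g => by rw [← Category.comp_id f, ← Category.comp_id g, h0]; simp⟩
  have h1 : Module.finrank ℂ (X ⟶ X) = 0 := Module.finrank_zero_of_subsingleton
  unfold IsSimpleObj at h
  omega

theorem IsSimpleObj.exists_scalar {X : C} (h : IsSimpleObj X) (f : X ⟶ X) :
    ∃ c : ℂ, f = c • 𝟙 X := by
  obtain ⟨c, hc⟩ := (finrank_eq_one_iff_of_nonzero' (𝟙 X) (IsSimpleObj.id_ne_zero h)).1 h f
  exact ⟨c, hc.symm⟩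

variable [CStarCat C]

theorem dag_id (X : C) : dag (𝟙 X) = 𝟙 X := by
  have h := CStarCat.dag_comp (dag (𝟙 X)) (𝟙 X)
  rw [Category.comp_id, CStarCat.dag_dag, Category.comp_id] at h
  exact h.symm

theorem dag_zero (X Y : C) : dag (0 : X ⟶ Y) = 0 := by
  have h := CStarCat.dag_smul (0 : ℂ) (0 : X ⟶ Y)
  simpa using h

/-- For `X` simple and `f : X ⟶ Y` nonzero, `f* f` is a positive multiple of the identity. -/
theorem exists_pos_scalar {X Y : C} (h : IsSimpleObj X) (f : X ⟶ Y) (hf : f ≠ 0) :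
    ∃ c : ℝ, 0 < c ∧ f ≫ dag f = (c : ℂ) • 𝟙 X := by
  obtain ⟨g, hg⟩ := CStarCat.comp_dag_pos f
  obtain ⟨z, rfl⟩ := IsSimpleObj.exists_scalar h g
  have h1 : f ≫ dag f = ((‖z‖ ^ 2 : ℝ) : ℂ) • 𝟙 X := by
    rw [hg, CStarCat.dag_smul, dag_id, Linear.smul_comp, Linear.comp_smul, Category.comp_id,
      smul_smul, Complex.mul_conj']
    push_cast
    rfl
  refine ⟨‖z‖ ^ 2, ?_, h1⟩
  rcases (sq_nonneg ‖z‖).lt_or_eq with h2 | h2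
  · exact h2
  · exfalso
    rw [← h2] at h1
    apply hf
    rw [← CStarCat.norm_eq_zero]
    have h3 := CStarCat.norm_comp_dag f
    rw [h1, (CStarCat.norm_eq_zero _).2 (by simp)] at h3
    exact pow_eq_zero_iff (two_ne_zero) |>.1 h3.symm

/-- A nonzero morphism between simple objects rescales to a unitary. -/
theorem exists_unitary {X Y : C} (hX : IsSimpleObj X) (hY : IsSimpleObj Y) (f : X ⟶ Y)
    (hf : f ≠ 0) : ∃ g : X ⟶ Y, g ≫ dag g = 𝟙 X ∧ dag g ≫ g = 𝟙 Y := by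
  obtain ⟨c, hc, hfc⟩ := exists_pos_scalar hX f hf
  have hf' : dag f ≠ 0 := fun h => hf (by rw [← CStarCat.dag_dag f, h, dag_zero])
  obtain ⟨e, he, hfe⟩ := exists_pos_scalar hY (dag f) hf'
  rw [CStarCat.dag_dag] at hfe
  have hce : c = e := by
    have h1 : (c : ℂ) • f = (e : ℂ) • f := by
      calc (c : ℂ) • f = (f ≫ dag f) ≫ f := by rw [hfc, Linear.smul_comp, Category.id_comp]
        _ = f ≫ (dag f ≫ f) := by rw [Category.assoc]
        _ = (e : ℂ) • f := by rw [hfe, Linear.comp_smul, Category.comp_id]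
    exact_mod_cast smul_left_injective ℂ hf h1
  subst hce
  have hs : ((Real.sqrt c : ℂ))⁻¹ * ((Real.sqrt c : ℂ))⁻¹ * (c : ℂ) = 1 := by
    have : (Real.sqrt c : ℂ) * (Real.sqrt c : ℂ) = c := by
      exact_mod_cast Real.mul_self_sqrt hc.le
    have hc' : (c : ℂ) ≠ 0 := by exact_mod_cast hc.ne'
    rw [← mul_inv, this, inv_mul_cancel₀ hc']
  have hconj : conj ((Real.sqrt c : ℂ)⁻¹) = (Real.sqrt c : ℂ)⁻¹ := by
    rw [map_inv₀, Complex.conj_ofReal]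
  refine ⟨((Real.sqrt c : ℂ))⁻¹ • f, ?_, ?_⟩
  · rw [CStarCat.dag_smul, hconj, Linear.smul_comp, Linear.comp_smul, hfc, smul_smul, smul_smul,
      hs, one_smul]
  · rw [CStarCat.dag_smul, hconj, Linear.smul_comp, Linear.comp_smul, hfe, smul_smul, smul_smul,
      hs, one_smul]

theorem nonempty_iso_of_ne_zero {X Y : C} (hX : IsSimpleObj X) (hY : IsSimpleObj Y) (f : X ⟶ Y)
    (hf : f ≠ 0) : Nonempty (X ≅ Y) := by
  obtain ⟨g, h1, h2⟩ := exists_unitary hX hY f hf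
  exact ⟨⟨g, dag g, h1, h2⟩⟩

/-- `V` is an orthonormal basis of `C(k, z)` for `⟨σ, τ⟩ 1 = τ* σ` (for simple `k`). -/
def IsOnb {k z : C} {n : ℕ} (V : Fin n → (k ⟶ z)) : Prop :=
  (∀ i j, V i ≫ dag (V j) = if i = j then 𝟙 k else 0) ∧ Submodule.span ℂ (Set.range V) = ⊤

end Basic

section Irr

variable (C : Type u) [Category.{v} C] [Preadditive C] [Linear ℂ C]

/-- Isomorphism of simple objects. -/
def simpleSetoid : Setoid {X : C // IsSimpleObj X} where
  r X Y := Nonempty (X.1 ≅ Y.1)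
  iseqv := ⟨fun X => ⟨Iso.refl X.1⟩, fun ⟨a⟩ => ⟨a.symm⟩, fun ⟨a⟩ ⟨b⟩ => ⟨a.trans b⟩⟩

/-- The set of isomorphism classes of simple objects. -/
def Irr : Type u := Quotient (simpleSetoid C)

variable {C}

/-- The isomorphism class of a simple object. -/
def Irr.mk (X : C) (h : IsSimpleObj X) : Irr C := Quotient.mk (simpleSetoid C) ⟨X, h⟩

/-- The fixed representative of a class of simple objects. -/
noncomputable def Irr.rep (w : Irr C) : C := (Quotient.out w).1

theorem Irr.simple (w : Irr C) : IsSimpleObj w.rep := (Quotient.out w).2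

theorem Irr.rep_mk (X : C) (h : IsSimpleObj X) : Nonempty ((Irr.mk X h).rep ≅ X) :=
  Quotient.exact (s := simpleSetoid C) (Quotient.out_eq (s := simpleSetoid C) (Irr.mk X h))

theorem Irr.ext_iso {w w' : Irr C} (h : Nonempty (w.rep ≅ w'.rep)) : w = w' := by
  have h1 := Quotient.sound (s := simpleSetoid C) (a := Quotient.out w) (b := Quotient.out w') h
  exact (Quotient.out_eq (s := simpleSetoid C) w).symm.trans
    (h1.trans (Quotient.out_eq (s := simpleSetoid C) w'))

end Irr

section Rigid

variable {C : Type u} [Category.{v} C] [Preadditive C] [Linear ℂ C]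
  [MonoidalCategory C] [MonoidalPreadditive C] [MonoidalLinear ℂ C] [CStarCat C]

section

variable [CStarTensorCat C]

set_option linter.unusedSectionVars false

/-- A solution of the conjugate equations is an exact pairing with coevaluation `R̄` and
evaluation `R*`. -/
@[reducible] def ConjSolution.toExactPairing {X Y : C} (s : ConjSolution X Y) : ExactPairing X Y where
  coevaluation' := s.Rbar
  evaluation' := dag s.R
  coevaluation_evaluation' := by
    have h := congrArg dag s.conj_eq
    have e1 : dag (ρ_ Y).hom = (ρ_ Y).inv := CStarTensorCat.dag_rightUnitor Y
    have e2 : dag (λ_ Y).inv = (λ_ Y).hom := by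
      rw [← CStarTensorCat.dag_leftUnitor, CStarCat.dag_dag]
    simp only [CStarCat.dag_comp, CStarTensorCat.dag_whiskerLeft, CStarTensorCat.dag_whiskerRight,
      CStarTensorCat.dag_associator, CStarCat.dag_dag, dag_id, e1, e2, Category.assoc] at h
    rw [← cancel_epi (ρ_ Y).inv, ← cancel_mono (λ_ Y).hom]
    simpa using h
  evaluation_coevaluation' := by
    have h := s.conj_eq'
    rw [← cancel_epi (λ_ X).inv, ← cancel_mono (ρ_ X).hom]
    simpa using h

/-- An exact pairing is a solution of the conjugate equations. -/
def ConjSolution.ofExactPairing {X Y : C} (p : ExactPairing X Y) : ConjSolution X Y where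
  R := dag p.evaluation'
  Rbar := p.coevaluation'
  conj_eq := by
    have h := congrArg dag p.coevaluation_evaluation'
    have e1 : dag (ρ_ Y).hom = (ρ_ Y).inv := CStarTensorCat.dag_rightUnitor Y
    have e2 : dag (λ_ Y).inv = (λ_ Y).hom := by
      rw [← CStarTensorCat.dag_leftUnitor, CStarCat.dag_dag]
    have e3 : dag (α_ Y X Y).inv = (α_ Y X Y).hom := by
      rw [← CStarTensorCat.dag_associator, CStarCat.dag_dag]
    simp only [CStarCat.dag_comp, CStarTensorCat.dag_whiskerLeft, CStarTensorCat.dag_whiskerRight,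
      e1, e2, e3, Category.assoc] at h
    rw [reassoc_of% h]
    simp
  conj_eq' := by
    have h := p.evaluation_coevaluation'
    rw [CStarCat.dag_dag, reassoc_of% h]
    simp

/-- If `(R, R̄)` solves the conjugate equations for `(X, Y)`, then `(R̄, R)` does so for
`(Y, X)`. -/
def ConjSolution.symm {X Y : C} (s : ConjSolution X Y) : ConjSolution Y X where
  R := s.Rbar
  Rbar := s.R
  conj_eq := s.conj_eq'
  conj_eq' := s.conj_eq

/-- A dual of a simple object is simple, as `End Y ≅ End X`. -/
theorem IsSimpleObj.of_exactPairing {X Y : C} (p : ExactPairing X Y) (h : IsSimpleObj X) :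
    IsSimpleObj Y := by
  let e : (Y ⟶ Y) ≃ (X ⟶ X) :=
    ((ρ_ Y).homFromEquiv (Z := Y)).symm.trans <|
      (tensorLeftHomEquiv (𝟙_ C) X Y Y).trans <|
        (tensorRightHomEquiv (𝟙_ C) X Y X).symm.trans (λ_ X).homFromEquiv
  have hlin : IsLinearMap ℂ e := by
    constructor
    · intro f g
      simp [e, tensorLeftHomEquiv, tensorRightHomEquiv]
    · intro c f
      simp [e, tensorLeftHomEquiv, tensorRightHomEquiv]
  have := (e.toLinearEquiv hlin).finrank_eq
  unfold IsSimpleObj at h ⊢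
  omega

end

variable [RigidCStarTensorCat C]

theorem exists_standard {X Y : C} (hX : IsSimpleObj X) (s : ConjSolution X Y) :
    ∃ t : ConjSolution X Y, t.IsStandard := by
  have hR : s.R ≠ 0 := by
    intro h
    apply IsSimpleObj.id_ne_zero hX
    have := s.conj_eq'
    rw [h, dag_zero] at this
    simpa using this.symm
  have hRb : s.Rbar ≠ 0 := by
    intro h
    apply IsSimpleObj.id_ne_zero hX
    have := s.conj_eq'
    rw [h] at this
    simpa using this.symm
  have hu : IsSimpleObj (𝟙_ C) := RigidCStarTensorCat.simple_unit
  obtain ⟨a, ha, hRa⟩ := exists_pos_scalar hu s.R hR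
  obtain ⟨b, hb, hRb⟩ := exists_pos_scalar hu s.Rbar hRb
  obtain ⟨r, hr, hrab⟩ : ∃ r : ℝ, 0 < r ∧ r * r * a = r⁻¹ * r⁻¹ * b := by
    have hq : 0 < Real.sqrt (b / a) := Real.sqrt_pos.2 (div_pos hb ha)
    refine ⟨Real.sqrt (Real.sqrt (b / a)), Real.sqrt_pos.2 hq, ?_⟩
    rw [← mul_inv, Real.mul_self_sqrt hq.le, inv_mul_eq_div, eq_div_iff hq.ne']
    calc Real.sqrt (b / a) * a * Real.sqrt (b / a)
        = (Real.sqrt (b / a) * Real.sqrt (b / a)) * a := by ring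
      _ = b := by rw [Real.mul_self_sqrt (div_pos hb ha).le]; field_simp
  have hr' : (r : ℂ) ≠ 0 := by exact_mod_cast hr.ne'
  refine ⟨⟨(r : ℂ) • s.R, (r : ℂ)⁻¹ • s.Rbar, ?_, ?_⟩, ?_⟩
  · have := s.conj_eq
    rw [CStarCat.dag_smul, map_inv₀, Complex.conj_ofReal]
    simpa [-Complex.coe_smul, smul_smul, hr'] using this
  · have := s.conj_eq'
    rw [CStarCat.dag_smul, Complex.conj_ofReal]
    simpa [-Complex.coe_smul, smul_smul, hr'] using this
  · intro f
    obtain ⟨c, rfl⟩ := IsSimpleObj.exists_scalar hX f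
    have : (r : ℂ) * r * a = (r : ℂ)⁻¹ * (r : ℂ)⁻¹ * b := by exact_mod_cast hrab
    simp only [CStarCat.dag_smul, map_inv₀, Complex.conj_ofReal, Linear.smul_comp,
      Linear.comp_smul, MonoidalLinear.whiskerLeft_smul, MonoidalLinear.smul_whiskerRight,
      whiskerLeft_id, id_whiskerRight, Category.id_comp, hRa, hRb, smul_smul]
    congr 1
    linear_combination c * this

theorem Irr.exists_conj (w : Irr C) :
    ∃ w' : Irr C, ∃ s : ConjSolution w.rep w'.rep, s.IsStandard := by
  obtain ⟨Y, ⟨s⟩⟩ := RigidCStarTensorCat.exists_conj w.rep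
  have hY : IsSimpleObj Y := IsSimpleObj.of_exactPairing (ConjSolution.toExactPairing s) w.simple
  obtain ⟨i⟩ := Irr.rep_mk Y hY
  let _ := ConjSolution.toExactPairing s
  exact ⟨Irr.mk Y hY,
    exists_standard w.simple (ConjSolution.ofExactPairing (exactPairingCongrRight i))⟩

/-- The conjugate `w̄` of `w ∈ Irr`. -/
noncomputable def Irr.conj (w : Irr C) : Irr C := (Irr.exists_conj w).choose

/-- The fixed standard solution `(R, R̄)` for `(w, w̄)`. -/
noncomputable def Irr.std (w : Irr C) : ConjSolution w.rep w.conj.rep :=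
  (Irr.exists_conj w).choose_spec.choose

theorem Irr.std_isStandard (w : Irr C) : w.std.IsStandard :=
  (Irr.exists_conj w).choose_spec.choose_spec

theorem Irr.conj_conj (w : Irr C) : w.conj.conj = w :=
  Irr.ext_iso ⟨rightDualIso (ConjSolution.toExactPairing w.conj.std)
    (ConjSolution.toExactPairing (ConjSolution.symm w.std))⟩

theorem Irr.exists_dim (w : Irr C) :
    ∃ d : ℝ, 0 < d ∧ w.std.R ≫ dag w.std.R = (d : ℂ) • 𝟙 (𝟙_ C) := by
  refine exists_pos_scalar RigidCStarTensorCat.simple_unit _ fun h => ?_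
  apply IsSimpleObj.id_ne_zero w.simple
  have := w.std.conj_eq'
  rw [h, dag_zero] at this
  simpa using this.symm

/-- The categorical dimension `d(w) = R* R` (a positive multiple of the identity of the unit). -/
noncomputable def Irr.dim (w : Irr C) : ℝ := (Irr.exists_dim w).choose

theorem Irr.dim_spec (w : Irr C) :
    0 < w.dim ∧ w.std.R ≫ dag w.std.R = (w.dim : ℂ) • 𝟙 (𝟙_ C) := (Irr.exists_dim w).choose_spec

theorem exists_onb (k : Irr C) (z : C) : ∃ (n : ℕ) (V : Fin n → (k.rep ⟶ z)), IsOnb V := by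
  classical
  obtain ⟨n, s, a, hs, ha, hab, hsum⟩ := RigidCStarTensorCat.semisimple z
  let ι := {i : Fin n // ∃ f : k.rep ⟶ s i, f ≠ 0}
  choose g hg1 hg2 using fun i : ι => exists_unitary k.simple (hs i.1) i.2.choose i.2.choose_spec
  let e : Fin (Fintype.card ι) ≃ ι := (Fintype.equivFin ι).symm
  refine ⟨Fintype.card ι, fun j => g (e j) ≫ a (e j).1, ?_, ?_⟩
  · intro i j
    rw [CStarCat.dag_comp, Category.assoc]
    split_ifs with hij
    · subst hij
      rw [reassoc_of% (ha (e i).1), hg1]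
    · have : (e i).1 ≠ (e j).1 := fun h => hij (e.injective (Subtype.ext h))
      rw [reassoc_of% (hab _ _ this)]
      simp
  · rw [eq_top_iff]
    intro f _
    have hf : f = ∑ i, (f ≫ dag (a i)) ≫ a i := by
      simp only [Category.assoc]
      rw [← Preadditive.comp_sum, hsum, Category.comp_id]
    rw [hf]
    refine Submodule.sum_mem _ fun i _ => ?_
    by_cases h0 : f ≫ dag (a i) = 0
    · rw [h0, Limits.zero_comp]
      exact Submodule.zero_mem _
    · let t : ι := ⟨i, _, h0⟩
      obtain ⟨c, hc⟩ := IsSimpleObj.exists_scalar k.simple ((f ≫ dag (a i)) ≫ dag (g t))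
      have h1 : f ≫ dag (a i) = c • g t := by
        calc f ≫ dag (a i) = ((f ≫ dag (a i)) ≫ dag (g t)) ≫ g t := by
              rw [Category.assoc, hg2, Category.comp_id]
          _ = c • g t := by rw [hc, Linear.smul_comp, Category.id_comp]
      rw [h1, Linear.smul_comp]
      refine Submodule.smul_mem _ _ (Submodule.subset_span ⟨e.symm t, ?_⟩)
      change g (e (e.symm t)) ≫ a (e (e.symm t)).1 = g t ≫ a t.1
      rw [Equiv.apply_symm_apply]

theorem finite_irr_hom (z : C) : {w : Irr C | ∃ f : w.rep ⟶ z, f ≠ 0}.Finite := by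
  obtain ⟨n, s, a, hs, ha, hab, hsum⟩ := RigidCStarTensorCat.semisimple z
  refine (Set.finite_range fun i => Irr.mk (s i) (hs i)).subset ?_
  rintro w ⟨f, hf⟩
  have hf' : f = ∑ i, (f ≫ dag (a i)) ≫ a i := by
    simp only [Category.assoc]
    rw [← Preadditive.comp_sum, hsum, Category.comp_id]
  obtain ⟨i, hi⟩ : ∃ i, f ≫ dag (a i) ≠ 0 := by
    by_contra! h
    apply hf
    rw [hf']
    simp [h]
  obtain ⟨j⟩ := nonempty_iso_of_ne_zero w.simple (hs i) _ hi
  obtain ⟨l⟩ := Irr.rep_mk (s i) (hs i)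
  exact ⟨i, Irr.ext_iso ⟨l ≪≫ j.symm⟩⟩

/-- The number of elements of an orthonormal basis of `C(k, z)`. -/
noncomputable def onbCard (k : Irr C) (z : C) : ℕ := (exists_onb k z).choose

/-- A fixed orthonormal basis of `C(k, z)`. -/
noncomputable def onb (k : Irr C) (z : C) : Fin (onbCard k z) → (k.rep ⟶ z) :=
  (exists_onb k z).choose_spec.choose

theorem onb_spec (k : Irr C) (z : C) : IsOnb (onb k z) := (exists_onb k z).choose_spec.choose_spec

/-- The space `A_{x,y} = ⨁_{w ∈ Irr} C(w ⊗ x, y ⊗ w)` of the tube algebra. -/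
abbrev Tube (x y : C) : Type (max u v) := Π₀ w : Irr C, (w.rep ⊗ x ⟶ y ⊗ w.rep)

open Classical in
/-- The map `Ψ^z_{x,y} : C(z ⊗ x, y ⊗ z) → A_{x,y}` whose component at `k ∈ Irr` is
`∑_V (1_y ⊗ V*) γ (V ⊗ 1_x)`, `V` in an orthonormal basis of `C(k, z)`. -/
noncomputable def tubePsi {x y : C} (z : C) (γ : z ⊗ x ⟶ y ⊗ z) : Tube x y :=
  DFinsupp.mk (finite_irr_hom z).toFinset fun k =>
    ∑ i, onb k.1 z i ▷ x ≫ γ ≫ y ◁ dag (onb k.1 z i)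

/-- The formula for `Ψ^z` holds for every `k` (both sides vanish if `C(k, z) = 0`). -/
theorem tubePsi_apply {x y : C} (z : C) (γ : z ⊗ x ⟶ y ⊗ z) (k : Irr C) :
    tubePsi z γ k = ∑ i, onb k z i ▷ x ≫ γ ≫ y ◁ dag (onb k z i) := by
  classical
  rw [tubePsi, DFinsupp.mk_apply]
  split_ifs with h
  · rfl
  · symm
    refine Finset.sum_eq_zero fun i _ => ?_
    have : onb k z i = 0 := by
      by_contra h0
      exact h ((finite_irr_hom z).mem_toFinset.2 ⟨_, h0⟩)
    rw [this]
    simp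

open Classical in
/-- The multiplication `A_{s,j} × A_{i,s} → A_{i,j}` of the tube algebra: on components
`a ∈ C(m ⊗ s, j ⊗ m)` and `b ∈ C(l ⊗ i, s ⊗ l)` it is `Ψ^{m ⊗ l}((a ⊗ 1_l)(1_m ⊗ b))`. -/
noncomputable def tubeMul {i s j : C} (a : Tube s j) (b : Tube i s) : Tube i j :=
  ∑ m ∈ a.support, ∑ l ∈ b.support,
    tubePsi (m.rep ⊗ l.rep)
      ((α_ m.rep l.rep i).hom ≫ m.rep ◁ b l ≫ (α_ m.rep s l.rep).inv ≫ a m ▷ l.rep ≫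
        (α_ j m.rep l.rep).hom)

open Classical in
/-- The involution `A_{x,y} → A_{y,x}` of the tube algebra: the component of `a*` at `k` is
`(R̄* ⊗ 1_x ⊗ 1_k)(1_k ⊗ (a_{k̄})* ⊗ 1_k)(1_k ⊗ 1_y ⊗ R)`, `(R, R̄)` standard for `(k, k̄)`.
(It vanishes unless `k̄` lies in the support of `a`, that is, `k = l̄` with `l` in the
support.) -/
noncomputable def tubeStar {x y : C} (a : Tube x y) : Tube y x :=
  DFinsupp.mk (a.support.image Irr.conj) fun k =>
    (ρ_ (k.1.rep ⊗ y)).inv ≫ (k.1.rep ⊗ y) ◁ k.1.std.R ≫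
      (α_ (k.1.rep ⊗ y) k.1.conj.rep k.1.rep).inv ≫ (α_ k.1.rep y k.1.conj.rep).hom ▷ k.1.rep ≫
      (k.1.rep ◁ dag (a k.1.conj)) ▷ k.1.rep ≫ (α_ k.1.rep k.1.conj.rep x).inv ▷ k.1.rep ≫
      (dag k.1.std.Rbar ▷ x) ▷ k.1.rep ≫ (λ_ x).hom ▷ k.1.rep

/-- The formula for the involution holds for every `k`. -/
theorem tubeStar_apply {x y : C} (a : Tube x y) (k : Irr C) :
    tubeStar a k =
      (ρ_ (k.rep ⊗ y)).inv ≫ (k.rep ⊗ y) ◁ k.std.R ≫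
        (α_ (k.rep ⊗ y) k.conj.rep k.rep).inv ≫ (α_ k.rep y k.conj.rep).hom ▷ k.rep ≫
        (k.rep ◁ dag (a k.conj)) ▷ k.rep ≫ (α_ k.rep k.conj.rep x).inv ▷ k.rep ≫
        (dag k.std.Rbar ▷ x) ▷ k.rep ≫ (λ_ x).hom ▷ k.rep := by
  classical
  rw [tubeStar, DFinsupp.mk_apply]
  split_ifs with h
  · rfl
  · have : a k.conj = 0 := by
      by_contra h0
      exact h (Finset.mem_image.2 ⟨k.conj, DFinsupp.mem_support_iff.2 h0, Irr.conj_conj k⟩)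
    rw [this, dag_zero]
    simp

variable (C) in
/-- The fusion algebra `ℂ[C]`: the complex linear span of `Irr`. -/
abbrev FusionAlg : Type u := Irr C →₀ ℂ

open Classical in
/-- The identification `ℂ[C] ≅ A_{𝟙,𝟙}`, `w ↦ 1_w ∈ C(w ⊗ 𝟙, 𝟙 ⊗ w)`, extended linearly. The
multiplication and the involution of `ℂ[C]` are those of `A_{𝟙,𝟙}`. -/
noncomputable def fusionToTube (a : FusionAlg C) : Tube (𝟙_ C) (𝟙_ C) :=
  a.sum fun w c => DFinsupp.single w (c • ((ρ_ w.rep).hom ≫ (λ_ w.rep).inv))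

variable (C) in
/-- The tube cone `Σ²C ⊆ ℂ[C] = A_{𝟙,𝟙}`: all finite sums `∑ aᵢ aᵢ*` with `aᵢ ∈ A_{xᵢ,𝟙}`,
`xᵢ ∈ Irr`. -/
def tubeCone : Set (FusionAlg C) :=
  {b | ∃ (n : ℕ) (x : Fin n → Irr C) (a : ∀ i, Tube (x i).rep (𝟙_ C)),
    fusionToTube b = ∑ i, tubeMul (a i) (tubeStar (a i))}

variable (C) in
/-- The class of the unit object. -/
def Irr.unit : Irr C := Irr.mk (𝟙_ C) RigidCStarTensorCat.simple_unit

/-- `S` is symmetric: `α ∈ S` if and only if `ᾱ ∈ S`. -/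
def IsSymmetricSet (S : Finset (Irr C)) : Prop := ∀ w : Irr C, w ∈ S ↔ w.conj ∈ S

/-- `S` is generating: every `w ∈ Irr` is a subobject of `s₁ ⊗ ⋯ ⊗ sₙ` for some
`s₁, …, sₙ ∈ S`, `n ≥ 1`. -/
def IsGeneratingSet (S : Finset (Irr C)) : Prop :=
  ∀ w : Irr C, ∃ (s : Irr C) (L : List (Irr C)), s ∈ S ∧ (∀ t ∈ L, t ∈ S) ∧
    ∃ a : w.rep ⟶ L.foldl (fun X t => X ⊗ t.rep) s.rep, a ≫ dag a = 𝟙 w.rep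

/-- The constant `κ = ∑_{α ∈ S} ν(α) d(α)`. -/
noncomputable def kappa (S : Finset (Irr C)) (ν : Irr C → ℝ) : ℝ := ∑ w ∈ S, ν w * w.dim

/-- The Laplacian `Δ = 𝟙 - κ⁻¹ ∑_{α ∈ S} ν(α) α` in `ℂ[C]`. -/
noncomputable def laplacian (S : Finset (Irr C)) (ν : Irr C → ℝ) : FusionAlg C :=
  Finsupp.single (Irr.unit C) 1 -
    ((kappa S ν : ℂ)⁻¹) • ∑ w ∈ S, Finsupp.single w (ν w : ℂ)

end Rigid

end CStarTensor

/-! Since `S` and `ν` are invariant under conjugation, `Δ` is `1/(2κ)` times the sum over `w ∈ S` of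
`ν(w) (2 d(w) 𝟙 - w - w̄)`. The tube cone is closed under sums and nonnegative multiples, so it
suffices to treat one `w` (`two_dim_sub_mem_tubeCone`).

For one `w` the element is a single square `a a*`, where `a = R* - (R̄* ⊗ 1)` lies in `A_{w̄ ⊗ w,
𝟙}`, with parts in degrees `𝟙` and `w`. The diagonal terms of `a a*` are the loops `R* R` and `R̄*
R̄`, both equal to `d(w)` because the solution is standard; the cross terms are zigzags, which the
conjugate equations straighten to `w` and `w̄`. The colour `w̄ ⊗ w` need not be simple, but if `∑ Vᵢ
Vᵢ* = 1` with each `Vᵢ` defined on a simple object, then `a a* = ∑ (a Vᵢ)(a Vᵢ)*`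
(`sum_tubeMulHom`), as the cone demands.

Two facts make the computation independent of choices. `rotate_eq`: the adjoint is the same for
every solution of the conjugate equations. `tubePsi_cyclic`: `Ψ` is tracial, so products can be
evaluated without decomposing `m ⊗ l`. -/

namespace CStarTensor

/-! ### Expansion in orthonormal bases -/

section Onb

variable {C : Type u} [Category.{v} C] [Preadditive C] [Linear ℂ C] [CStarCat C]

theorem dag_sum {X Y : C} {ι : Type*} (s : Finset ι) (f : ι → (X ⟶ Y)) :
    dag (∑ i ∈ s, f i) = ∑ i ∈ s, dag (f i) := by
  classical
  induction s using Finset.induction_on with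
  | empty => simp [dag_zero]
  | insert i s hi ih => rw [Finset.sum_insert hi, Finset.sum_insert hi, CStarCat.dag_add, ih]

theorem IsOnb.sum_comp {k z : C} {n : ℕ} {V : Fin n → (k ⟶ z)} (hV : IsOnb V) (f : k ⟶ z) :
    ∑ i, (f ≫ dag (V i)) ≫ V i = f := by
  have hf : f ∈ Submodule.span ℂ (Set.range V) := hV.2 ▸ Submodule.mem_top
  induction hf using Submodule.span_induction with
  | mem x hx =>
    obtain ⟨j, rfl⟩ := hx
    rw [Finset.sum_eq_single j]
    · rw [hV.1, if_pos rfl, Category.id_comp]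
    · intro i _ hij
      rw [hV.1, if_neg hij.symm, Limits.zero_comp]
    · simp
  | zero => simp
  | add x y _ _ hx hy =>
    simp only [Preadditive.add_comp, Finset.sum_add_distrib, hx, hy]
  | smul a x _ hx => simp only [Linear.smul_comp, ← Finset.smul_sum, hx]

theorem IsOnb.sum_dag_comp {k z : C} {n : ℕ} {V : Fin n → (k ⟶ z)} (hV : IsOnb V) (f : z ⟶ k) :
    ∑ i, dag (V i) ≫ V i ≫ f = f := by
  have h := congrArg dag (hV.sum_comp (dag f))
  simpa only [dag_sum, CStarCat.dag_comp, CStarCat.dag_dag] using h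

theorem exists_unitary_of_iso {X Y : C} (hX : IsSimpleObj X) (hY : IsSimpleObj Y)
    (i : X ≅ Y) : ∃ g : X ⟶ Y, g ≫ dag g = 𝟙 X ∧ dag g ≫ g = 𝟙 Y :=
  exists_unitary hX hY i.hom fun h => IsSimpleObj.id_ne_zero hX (by rw [← i.hom_inv_id, h]; simp)

end Onb

variable {C : Type u} [Category.{v} C] [Preadditive C] [Linear ℂ C]
  [MonoidalCategory C] [MonoidalPreadditive C] [MonoidalLinear ℂ C] [CStarCat C]

/-! ### The adjoint as a rotation, and its independence of the solution -/

section Rotation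

variable [CStarTensorCat C]

theorem dag_associator_inv (X Y Z : C) : dag (α_ X Y Z).inv = (α_ X Y Z).hom := by
  rw [← CStarTensorCat.dag_associator, CStarCat.dag_dag]

theorem dag_leftUnitor_inv (X : C) : dag (λ_ X).inv = (λ_ X).hom := by
  rw [← CStarTensorCat.dag_leftUnitor, CStarCat.dag_dag]

theorem dag_rightUnitor_inv (X : C) : dag (ρ_ X).inv = (ρ_ X).hom := by
  rw [← CStarTensorCat.dag_rightUnitor, CStarCat.dag_dag]

/-- The rotated adjoint `(R̄* ⊗ 1_x ⊗ 1)(1 ⊗ γ* ⊗ 1)(1 ⊗ 1_y ⊗ R)` of `γ ∈ C(Y ⊗ x, y ⊗ Y)`. -/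
def rotate {X Y x y : C} (s : ConjSolution X Y) (γ : Y ⊗ x ⟶ y ⊗ Y) :
    X ⊗ y ⟶ x ⊗ X :=
  (ρ_ (X ⊗ y)).inv ≫ (X ⊗ y) ◁ s.R ≫
    (α_ (X ⊗ y) Y X).inv ≫ (α_ X y Y).hom ▷ X ≫
    (X ◁ dag γ) ▷ X ≫ (α_ X Y x).inv ▷ X ≫
    (dag s.Rbar ▷ x) ▷ X ≫ (λ_ x).hom ▷ X

/-- This is `(a V)* = V* a*`: the morphism `V` on the colour strand passes the cap `R̄*` untouched.
It is what puts `V V*` in the middle of `(a V)(a V)*`. -/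
theorem rotate_whiskerLeft_comp {X Y x x' y : C} (s : ConjSolution X Y)
    (V : x' ⟶ x) (γ : Y ⊗ x ⟶ y ⊗ Y) :
    rotate s (Y ◁ V ≫ γ) = rotate s γ ≫ dag V ▷ X := by
  simp only [rotate, CStarCat.dag_comp, CStarTensorCat.dag_whiskerLeft, Category.assoc,
    MonoidalCategory.whiskerLeft_comp, comp_whiskerRight]
  simp only [← comp_whiskerRight]
  congr 5
  rw [associator_inv_naturality_right_assoc, whisker_exchange_assoc, leftUnitor_naturality]

/-- Inserting a zigzag of `s` on the `X` strand of `t.R` and sliding `t.R` past `s.R` exhibits `t.R`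
as `s.R` followed by an endomorphism of `Y`, which is a scalar. -/
theorem ConjSolution.R_eq_smul {X Y : C} (hY : IsSimpleObj Y) (s t : ConjSolution X Y) :
    ∃ c : ℂ, t.R = c • s.R := by
  obtain ⟨c, hc⟩ := IsSimpleObj.exists_scalar hY
    ((λ_ Y).inv ≫ t.R ▷ Y ≫ (α_ Y X Y).hom ≫ Y ◁ dag s.Rbar ≫ (ρ_ Y).hom)
  refine ⟨c, ?_⟩
  have key : t.R = s.R ≫ ((λ_ Y).inv ≫ t.R ▷ Y ≫ (α_ Y X Y).hom ≫ Y ◁ dag s.Rbar ≫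
      (ρ_ Y).hom) ▷ X := by
    have h := congrArg dag s.conj_eq'
    simp only [CStarCat.dag_comp, CStarTensorCat.dag_whiskerLeft, CStarTensorCat.dag_whiskerRight,
      CStarTensorCat.dag_associator, CStarCat.dag_dag, dag_id, dag_leftUnitor_inv,
      CStarTensorCat.dag_rightUnitor, Category.assoc] at h
    calc t.R = t.R ≫ Y ◁ ((ρ_ X).inv ≫ X ◁ s.R ≫ (α_ X Y X).inv ≫ dag s.Rbar ▷ X ≫
          (λ_ X).hom) := by rw [h]; simp
      _ = 𝟙 _ ⊗≫ (t.R ▷ 𝟙_ C ≫ (Y ⊗ X) ◁ s.R) ⊗≫ Y ◁ dag s.Rbar ▷ X ⊗≫ 𝟙 _ := by monoidal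
      _ = 𝟙 _ ⊗≫ (𝟙_ C ◁ s.R ≫ t.R ▷ (Y ⊗ X)) ⊗≫ Y ◁ dag s.Rbar ▷ X ⊗≫ 𝟙 _ := by
        rw [whisker_exchange]
      _ = _ := by monoidal
  rw [key, hc]
  simp

/-- Passing from `s` to `t` multiplies `R` by `c` and `R̄` by `d`. The rotation contains `R` and
`R̄*` once each, so it changes by `conj d * c`, and the conjugate equation forces this factor to be
1. -/
theorem rotate_eq {X Y x y : C} (hX : IsSimpleObj X) (hY : IsSimpleObj Y)
    (s t : ConjSolution X Y) (γ : Y ⊗ x ⟶ y ⊗ Y) : rotate s γ = rotate t γ := by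
  obtain ⟨c, hc⟩ := ConjSolution.R_eq_smul hY s t
  obtain ⟨d, hd⟩ := ConjSolution.R_eq_smul hX (ConjSolution.symm s) (ConjSolution.symm t)
  change t.Rbar = d • s.Rbar at hd
  have h1 : (conj d * c) • 𝟙 Y = (1 : ℂ) • 𝟙 Y := by
    conv_rhs => rw [one_smul, ← t.conj_eq, hc, hd]
    conv_lhs => rw [← s.conj_eq]
    simp only [CStarCat.dag_smul, MonoidalLinear.whiskerLeft_smul,
      MonoidalLinear.smul_whiskerRight, Linear.smul_comp, Linear.comp_smul, smul_smul]
  have h2 : conj d * c = 1 := smul_left_injective ℂ (IsSimpleObj.id_ne_zero hY) h1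
  simp only [rotate, hc, hd, CStarCat.dag_smul, MonoidalLinear.whiskerLeft_smul,
      MonoidalLinear.smul_whiskerRight, Linear.smul_comp, Linear.comp_smul, smul_smul]
  rw [h2, one_smul]

end Rotation

/-! ### The two homogeneous parts of the gradient and their adjoints -/

section Gradient

variable [CStarTensorCat C]

theorem ConjSolution.dag_conj_eq {X Y : C} (s : ConjSolution X Y) :
    (ρ_ Y).inv ≫ Y ◁ s.Rbar ≫ (α_ Y X Y).inv ≫ dag s.R ▷ Y ≫ (λ_ Y).hom = 𝟙 Y := by
  have h := congrArg dag s.conj_eq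
  simpa only [CStarCat.dag_comp, CStarTensorCat.dag_whiskerLeft, CStarTensorCat.dag_whiskerRight,
    CStarTensorCat.dag_associator, CStarCat.dag_dag, dag_id, dag_leftUnitor_inv,
    CStarTensorCat.dag_rightUnitor, Category.assoc] using h

theorem ConjSolution.dag_conj_eq' {X Y : C} (s : ConjSolution X Y) :
    (ρ_ X).inv ≫ X ◁ s.R ≫ (α_ X Y X).inv ≫ dag s.Rbar ▷ X ≫ (λ_ X).hom = 𝟙 X :=
  ConjSolution.dag_conj_eq (ConjSolution.symm s)

theorem conj_eq_of_unitary {U : C} (j : 𝟙_ C ⟶ U) (h1 : j ≫ dag j = 𝟙 _) (h2 : dag j ≫ j = 𝟙 U) :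
    (λ_ U).inv ≫ (j ≫ (ρ_ U).inv ≫ U ◁ j) ▷ U ≫ (α_ U U U).hom ≫
      U ◁ dag (j ≫ (ρ_ U).inv ≫ U ◁ j) ≫ (ρ_ U).hom = 𝟙 U := by
  simp only [CStarCat.dag_comp, CStarTensorCat.dag_whiskerLeft, dag_rightUnitor_inv]
  calc _ = 𝟙 _ ⊗≫ j ▷ U ⊗≫ U ◁ (j ▷ U ≫ U ◁ dag j) ⊗≫ U ◁ dag j ⊗≫ 𝟙 _ := by monoidal
    _ = 𝟙 _ ⊗≫ j ▷ U ⊗≫ U ◁ (𝟙_ C ◁ dag j ≫ j ▷ 𝟙_ C) ⊗≫ U ◁ dag j ⊗≫ 𝟙 _ := by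
      rw [whisker_exchange]
    _ = 𝟙 _ ⊗≫ (j ▷ U ≫ U ◁ dag j) ⊗≫ U ◁ (j ≫ dag j) ⊗≫ 𝟙 _ := by monoidal
    _ = 𝟙 _ ⊗≫ (𝟙_ C ◁ dag j ≫ j ▷ 𝟙_ C) ⊗≫ U ◁ 𝟙 _ ⊗≫ 𝟙 _ := by rw [whisker_exchange, h1]
    _ = dag j ≫ j := by monoidal
    _ = _ := h2

/-- An object unitarily isomorphic to the unit is its own conjugate. -/
def ConjSolution.ofUnitary {U : C} (j : 𝟙_ C ⟶ U) (h1 : j ≫ dag j = 𝟙 _) (h2 : dag j ≫ j = 𝟙 U) :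
    ConjSolution U U where
  R := j ≫ (ρ_ U).inv ≫ U ◁ j
  Rbar := j ≫ (ρ_ U).inv ≫ U ◁ j
  conj_eq := conj_eq_of_unitary j h1 h2
  conj_eq' := conj_eq_of_unitary j h1 h2

/-- The element of `C(U ⊗ x, 𝟙 ⊗ U)` defined by `r ∈ C(x, 𝟙)`, for `U` isomorphic to `𝟙`. -/
def unitHom {U x : C} (j : 𝟙_ C ⟶ U) (r : x ⟶ 𝟙_ C) : U ⊗ x ⟶ 𝟙_ C ⊗ U :=
  dag j ▷ x ≫ (λ_ x).hom ≫ r ≫ j ≫ (λ_ U).inv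

/-- The adjoint of `unitHom` in the tube algebra. -/
def unitHomStar {U x : C} (j : 𝟙_ C ⟶ U) (r : x ⟶ 𝟙_ C) : U ⊗ 𝟙_ C ⟶ x ⊗ U :=
  (ρ_ U).hom ≫ dag j ≫ dag r ≫ (ρ_ x).inv ≫ x ◁ j

/-- The rotation contains three copies each of `j` and `dag j`; interchange brings two pairs
together, where they cancel by `h1`. -/
theorem rotate_unitHom {U x : C} (j : 𝟙_ C ⟶ U) (h1 : j ≫ dag j = 𝟙 _) (h2 : dag j ≫ j = 𝟙 U)
    (r : x ⟶ 𝟙_ C) :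
    rotate (ConjSolution.ofUnitary j h1 h2) (unitHom j r) = unitHomStar j r := by
  simp only [rotate, unitHom, unitHomStar, ConjSolution.ofUnitary, CStarCat.dag_comp,
    CStarTensorCat.dag_whiskerLeft, CStarTensorCat.dag_whiskerRight, dag_rightUnitor_inv,
    dag_leftUnitor_inv, CStarTensorCat.dag_leftUnitor, CStarCat.dag_dag]
  calc _ = 𝟙 _ ⊗≫ U ◁ j ⊗≫ U ◁ (U ◁ j ≫ dag j ▷ U) ⊗≫ U ◁ dag r ▷ U ⊗≫
        U ◁ (j ≫ dag j) ▷ (x ⊗ U) ⊗≫ dag j ▷ (x ⊗ U) ⊗≫ 𝟙 _ := by monoidal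
    _ = 𝟙 _ ⊗≫ U ◁ j ⊗≫ U ◁ (dag j ▷ 𝟙_ C ≫ 𝟙_ C ◁ j) ⊗≫ U ◁ dag r ▷ U ⊗≫
        U ◁ (𝟙 (𝟙_ C)) ▷ (x ⊗ U) ⊗≫ dag j ▷ (x ⊗ U) ⊗≫ 𝟙 _ := by rw [whisker_exchange, h1]
    _ = 𝟙 _ ⊗≫ U ◁ (j ≫ dag j) ⊗≫ U ◁ (𝟙_ C ◁ j ≫ dag r ▷ U) ⊗≫ dag j ▷ (x ⊗ U) ⊗≫ 𝟙 _ := by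
      monoidal
    _ = 𝟙 _ ⊗≫ U ◁ (𝟙 (𝟙_ C)) ⊗≫ U ◁ (dag r ▷ 𝟙_ C ≫ x ◁ j) ⊗≫ dag j ▷ (x ⊗ U) ⊗≫ 𝟙 _ := by
      rw [whisker_exchange, h1]
    _ = 𝟙 _ ⊗≫ U ◁ dag r ⊗≫ (U ◁ (x ◁ j) ≫ dag j ▷ (x ⊗ U)) ⊗≫ 𝟙 _ := by monoidal
    _ = 𝟙 _ ⊗≫ U ◁ dag r ⊗≫ (dag j ▷ (x ⊗ 𝟙_ C) ≫ 𝟙_ C ◁ (x ◁ j)) ⊗≫ 𝟙 _ := by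
      rw [whisker_exchange]
    _ = 𝟙 _ ⊗≫ (U ◁ dag r ≫ dag j ▷ x) ⊗≫ x ◁ j ⊗≫ 𝟙 _ := by monoidal
    _ = 𝟙 _ ⊗≫ (dag j ▷ 𝟙_ C ≫ 𝟙_ C ◁ dag r) ⊗≫ x ◁ j ⊗≫ 𝟙 _ := by rw [whisker_exchange]
    _ = _ := by monoidal

/-- The element `R̄* ⊗ 1` of `C(X ⊗ (Y ⊗ X), 𝟙 ⊗ X)`. -/
def capHom {X Y : C} (s : ConjSolution X Y) : X ⊗ (Y ⊗ X) ⟶ 𝟙_ C ⊗ X :=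
  (α_ X Y X).inv ≫ dag s.Rbar ▷ X

/-- The adjoint `1 ⊗ R̄` of `capHom` in the tube algebra. -/
def capHomStar {X Y : C} (s : ConjSolution X Y) : Y ⊗ 𝟙_ C ⟶ (Y ⊗ X) ⊗ Y :=
  Y ◁ s.Rbar ≫ (α_ Y X Y).inv

/-- Of the two cups `R̄` in the rotation, one forms a zigzag with the cap `R*` and straightens; the
other survives. -/
theorem rotate_capHom {X Y : C} (s : ConjSolution X Y) :
    rotate (ConjSolution.symm s) (capHom s) = capHomStar s := by
  simp only [rotate, capHom, capHomStar, ConjSolution.symm, CStarCat.dag_comp,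
    CStarTensorCat.dag_whiskerRight, dag_associator_inv, CStarCat.dag_dag]
  calc _ = 𝟙 _ ⊗≫ Y ◁ (𝟙_ C ◁ s.Rbar ≫ s.Rbar ▷ (X ⊗ Y)) ⊗≫
        dag s.R ▷ (Y ⊗ (X ⊗ Y)) ⊗≫ 𝟙 _ := by monoidal
    _ = 𝟙 _ ⊗≫ Y ◁ (s.Rbar ▷ 𝟙_ C ≫ (X ⊗ Y) ◁ s.Rbar) ⊗≫
        dag s.R ▷ (Y ⊗ (X ⊗ Y)) ⊗≫ 𝟙 _ := by rw [whisker_exchange]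
    _ = 𝟙 _ ⊗≫ Y ◁ s.Rbar ⊗≫ ((Y ⊗ X) ◁ (Y ◁ s.Rbar) ≫ dag s.R ▷ (Y ⊗ (X ⊗ Y))) ⊗≫ 𝟙 _ := by
      monoidal
    _ = 𝟙 _ ⊗≫ Y ◁ s.Rbar ⊗≫ (dag s.R ▷ (Y ⊗ 𝟙_ C) ≫ 𝟙_ C ◁ (Y ◁ s.Rbar)) ⊗≫ 𝟙 _ := by
      rw [whisker_exchange]
    _ = 𝟙 _ ⊗≫ ((ρ_ Y).inv ≫ Y ◁ s.Rbar ≫ (α_ Y X Y).inv ≫ dag s.R ▷ Y ≫ (λ_ Y).hom) ⊗≫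
        Y ◁ s.Rbar ⊗≫ 𝟙 _ := by monoidal
    _ = _ := by rw [ConjSolution.dag_conj_eq s]; monoidal

end Gradient

variable [RigidCStarTensorCat C]

/-! ### Traciality and linearity of `Ψ` -/

/-- Orthonormal bases of `C(k, z)` and `C(k, z')` give `f` one matrix `c`, which describes both `f
Vᵢ` and `Wⱼ* f`. Both sides become the same double sum. -/
theorem tubePsi_cyclic {x y z z' : C} (f : z ⟶ z') (γ : z' ⊗ x ⟶ y ⊗ z) :
    tubePsi z (f ▷ x ≫ γ) = tubePsi z' (γ ≫ y ◁ f) := by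
  refine DFinsupp.ext fun k => ?_
  rw [tubePsi_apply, tubePsi_apply]
  choose c hc using fun i j =>
    IsSimpleObj.exists_scalar k.simple ((onb k z i ≫ f) ≫ dag (onb k z' j))
  have h1 : ∀ i, onb k z i ≫ f = ∑ j, c i j • onb k z' j := fun i => by
    rw [← (onb_spec k z').sum_comp (onb k z i ≫ f)]
    simp only [hc, Linear.smul_comp, Category.id_comp]
  have h2 : ∀ j, f ≫ dag (onb k z' j) = ∑ i, c i j • dag (onb k z i) := fun j => by
    rw [← (onb_spec k z).sum_dag_comp (f ≫ dag (onb k z' j))]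
    refine Finset.sum_congr rfl fun i _ => ?_
    rw [← Category.assoc (onb k z i), hc, Linear.comp_smul, Category.comp_id]
  have h3 : ∀ i, onb k z i ▷ x ≫ (f ▷ x ≫ γ) ≫ y ◁ dag (onb k z i) =
      ∑ j, c i j • (onb k z' j ▷ x ≫ γ ≫ y ◁ dag (onb k z i)) := fun i => by
    rw [Category.assoc, ← comp_whiskerRight_assoc, h1, sum_whiskerRight, Preadditive.sum_comp]
    simp only [MonoidalLinear.smul_whiskerRight, Linear.smul_comp]
  have h4 : ∀ j, onb k z' j ▷ x ≫ (γ ≫ y ◁ f) ≫ y ◁ dag (onb k z' j) =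
      ∑ i, c i j • (onb k z' j ▷ x ≫ γ ≫ y ◁ dag (onb k z i)) := fun j => by
    rw [Category.assoc, ← MonoidalCategory.whiskerLeft_comp, h2, whiskerLeft_sum,
      Preadditive.comp_sum, Preadditive.comp_sum]
    simp only [MonoidalLinear.whiskerLeft_smul, Linear.comp_smul]
  simp only [h3, h4]
  exact Finset.sum_comm

open Classical in
theorem tubePsi_rep {x y : C} (k : Irr C) (γ : k.rep ⊗ x ⟶ y ⊗ k.rep) :
    tubePsi k.rep γ = DFinsupp.single k γ := by
  refine DFinsupp.ext fun l => ?_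
  rw [tubePsi_apply]
  by_cases h : k = l
  · subst h
    rw [DFinsupp.single_eq_same]
    choose c hc using fun i => IsSimpleObj.exists_scalar k.simple (onb k k.rep i)
    -- Expanding the identity in the basis gives `∑ |cᵢ|² = 1`, so the number of basis vectors need
    -- not be determined.
    have h1 : (∑ i, conj (c i) * c i) • 𝟙 k.rep = (1 : ℂ) • 𝟙 k.rep := by
      conv_rhs => rw [one_smul, ← (onb_spec k k.rep).sum_comp (𝟙 k.rep)]
      rw [Finset.sum_smul]
      refine Finset.sum_congr rfl fun i _ => ?_
      rw [hc, CStarCat.dag_smul, dag_id]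
      simp only [Linear.comp_smul, Category.comp_id, smul_smul]
      rw [mul_comm]
    have h2 := smul_left_injective ℂ (IsSimpleObj.id_ne_zero k.simple) h1
    calc _ = ∑ i, (conj (c i) * c i) • γ := by
          refine Finset.sum_congr rfl fun i _ => ?_
          rw [hc, CStarCat.dag_smul, dag_id]
          simp only [Linear.smul_comp, Linear.comp_smul, MonoidalLinear.whiskerLeft_smul,
            MonoidalLinear.smul_whiskerRight, whiskerLeft_id, id_whiskerRight, Category.comp_id,
            Category.id_comp, smul_smul]
      _ = γ := by rw [← Finset.sum_smul, h2, one_smul]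
  · rw [DFinsupp.single_eq_of_ne (Ne.symm h)]
    refine Finset.sum_eq_zero fun i _ => ?_
    have : onb l k.rep i = 0 := by
      by_contra h0
      exact h (Irr.ext_iso (nonempty_iso_of_ne_zero l.simple k.simple _ h0)).symm
    rw [this]
    simp

theorem tubePsi_add {x y : C} (z : C) (γ δ : z ⊗ x ⟶ y ⊗ z) :
    tubePsi z (γ + δ) = tubePsi z γ + tubePsi z δ := by
  refine DFinsupp.ext fun k => ?_
  simp only [DFinsupp.add_apply, tubePsi_apply, Preadditive.add_comp, Preadditive.comp_add,
    Finset.sum_add_distrib]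

theorem tubePsi_smul {x y : C} (z : C) (c : ℂ) (γ : z ⊗ x ⟶ y ⊗ z) :
    tubePsi z (c • γ) = c • tubePsi z γ := by
  refine DFinsupp.ext fun k => ?_
  simp only [DFinsupp.smul_apply, tubePsi_apply, Linear.smul_comp, Linear.comp_smul,
    Finset.smul_sum]

/-! ### Products of homogeneous elements -/

/-- The product `Ψ^{m ⊗ l}((p ⊗ 1_l)(1_m ⊗ q))` of homogeneous elements of the tube algebra. -/
noncomputable def tubeMulHom {i s j : C} (m l : C) (p : m ⊗ s ⟶ j ⊗ m) (q : l ⊗ i ⟶ s ⊗ l) :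
    Tube i j :=
  tubePsi (m ⊗ l)
    ((α_ m l i).hom ≫ m ◁ q ≫ (α_ m s l).inv ≫ p ▷ l ≫ (α_ j m l).hom)

section

variable {i s j m l : C}

theorem tubeMulHom_add_left (p p' : m ⊗ s ⟶ j ⊗ m) (q : l ⊗ i ⟶ s ⊗ l) :
    tubeMulHom m l (p + p') q = tubeMulHom m l p q + tubeMulHom m l p' q := by
  simp only [tubeMulHom, ← tubePsi_add, MonoidalPreadditive.add_whiskerRight, Preadditive.add_comp,
    Preadditive.comp_add]

theorem tubeMulHom_add_right (p : m ⊗ s ⟶ j ⊗ m) (q q' : l ⊗ i ⟶ s ⊗ l) :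
    tubeMulHom m l p (q + q') = tubeMulHom m l p q + tubeMulHom m l p q' := by
  simp only [tubeMulHom, ← tubePsi_add, MonoidalPreadditive.whiskerLeft_add, Preadditive.add_comp,
    Preadditive.comp_add]

theorem tubeMulHom_smul_left (c : ℂ) (p : m ⊗ s ⟶ j ⊗ m) (q : l ⊗ i ⟶ s ⊗ l) :
    tubeMulHom m l (c • p) q = c • tubeMulHom m l p q := by
  simp only [tubeMulHom, ← tubePsi_smul, MonoidalLinear.smul_whiskerRight, Linear.smul_comp,
    Linear.comp_smul]

theorem tubeMulHom_smul_right (c : ℂ) (p : m ⊗ s ⟶ j ⊗ m) (q : l ⊗ i ⟶ s ⊗ l) :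
    tubeMulHom m l p (c • q) = c • tubeMulHom m l p q := by
  simp only [tubeMulHom, ← tubePsi_smul, MonoidalLinear.whiskerLeft_smul, Linear.smul_comp,
    Linear.comp_smul]

theorem tubeMulHom_zero_left (q : l ⊗ i ⟶ s ⊗ l) :
    tubeMulHom m l (0 : m ⊗ s ⟶ j ⊗ m) q = 0 := by
  simpa using tubeMulHom_smul_left 0 (0 : m ⊗ s ⟶ j ⊗ m) q

theorem tubeMulHom_zero_right (p : m ⊗ s ⟶ j ⊗ m) :
    tubeMulHom m l p (0 : l ⊗ i ⟶ s ⊗ l) = 0 := by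
  simpa using tubeMulHom_smul_right 0 p (0 : l ⊗ i ⟶ s ⊗ l)

/-- Inserting a resolution of the identity in the middle does not change the product. -/
theorem sum_tubeMulHom {ι : Type*} [Fintype ι] {x : ι → C} (V : ∀ a, x a ⟶ s)
    (hV : ∑ a, dag (V a) ≫ V a = 𝟙 s) (p : m ⊗ s ⟶ j ⊗ m) (q : l ⊗ i ⟶ s ⊗ l) :
    ∑ a, tubeMulHom m l (m ◁ V a ≫ p) (q ≫ dag (V a) ▷ l) = tubeMulHom m l p q := by
  -- Both factors meet on the strand `s`, so the product sees only `dag (V a) ≫ V a`, and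
  -- additively.
  let φ : (s ⟶ s) →+ Tube i j := AddMonoidHom.mk' (fun h => tubeMulHom m l (m ◁ h ≫ p) q)
    fun h h' => by rw [MonoidalPreadditive.whiskerLeft_add, Preadditive.add_comp, tubeMulHom_add_left]
  have h : ∀ a, tubeMulHom m l (m ◁ V a ≫ p) (q ≫ dag (V a) ▷ l) = φ (dag (V a) ≫ V a) := by
    intro a
    simp only [φ, AddMonoidHom.mk'_apply, tubeMulHom]
    congr 1
    simp
  simp only [h]
  rw [← map_sum, hV]
  simp [φ]

end

open Classical in
theorem tubeMul_eq_sum {i s j : C} (a : Tube s j) (b : Tube i s) :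
    tubeMul a b = a.sum fun m p => b.sum fun l q => tubeMulHom m.rep l.rep p q := rfl

open Classical in
theorem tubeMul_add_left {i s j : C} (a a' : Tube s j) (b : Tube i s) :
    tubeMul (a + a') b = tubeMul a b + tubeMul a' b := by
  simp only [tubeMul_eq_sum]
  refine DFinsupp.sum_add_index (fun m => ?_) fun m p p' => ?_
  · simp [tubeMulHom_zero_left, DFinsupp.sum]
  · simp [tubeMulHom_add_left, DFinsupp.sum, Finset.sum_add_distrib]

open Classical in
theorem tubeMul_add_right {i s j : C} (a : Tube s j) (b b' : Tube i s) :
    tubeMul a (b + b') = tubeMul a b + tubeMul a b' := by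
  simp only [tubeMul_eq_sum]
  rw [← DFinsupp.sum_add]
  refine Finset.sum_congr rfl fun m _ => DFinsupp.sum_add_index (fun l => ?_) fun l q q' => ?_
  · rw [tubeMulHom_zero_right]
  · rw [tubeMulHom_add_right]

open Classical in
theorem tubeMul_single {i s j : C} (m l : Irr C) (p : m.rep ⊗ s ⟶ j ⊗ m.rep)
    (q : l.rep ⊗ i ⟶ s ⊗ l.rep) :
    tubeMul (DFinsupp.single m p) (DFinsupp.single l q) = tubeMulHom m.rep l.rep p q := by
  rw [tubeMul_eq_sum, DFinsupp.sum_single_index, DFinsupp.sum_single_index]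
  · rw [tubeMulHom_zero_right]
  · simp [tubeMulHom_zero_left, DFinsupp.sum]

/-! ### The involution on homogeneous elements -/

theorem tubeStar_eq_rotate {x y : C} (a : Tube x y) (k : Irr C) :
    tubeStar a k = rotate k.std (a k.conj) := tubeStar_apply a k

theorem tubeStar_add {x y : C} (a b : Tube x y) : tubeStar (a + b) = tubeStar a + tubeStar b := by
  refine DFinsupp.ext fun k => ?_
  simp only [DFinsupp.add_apply, tubeStar_apply, CStarCat.dag_add, MonoidalPreadditive.whiskerLeft_add,
    MonoidalPreadditive.add_whiskerRight, Preadditive.add_comp, Preadditive.comp_add]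

theorem Irr.conj_eq_of_conjSolution {k w : Irr C} (s : ConjSolution k.rep w.rep) : k.conj = w :=
  Irr.ext_iso ⟨rightDualIso (ConjSolution.toExactPairing k.std)
    (ConjSolution.toExactPairing s)⟩

-- By `rotate_eq` the fixed standard solution may be replaced by any convenient one. This allows
-- `w.std` with its roles reversed in degree `w`, and a solution built from a unitary in the degree
-- of the unit.
open Classical in
theorem tubeStar_single {x y : C} {k w : Irr C} (s : ConjSolution k.rep w.rep)
    (γ : w.rep ⊗ x ⟶ y ⊗ w.rep) :
    tubeStar (DFinsupp.single w γ : Tube x y) = DFinsupp.single k (rotate s γ) := by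
  obtain rfl := Irr.conj_eq_of_conjSolution s
  refine DFinsupp.ext fun l => ?_
  rw [tubeStar_eq_rotate]
  by_cases h : k = l
  · subst h
    rw [DFinsupp.single_eq_same, DFinsupp.single_eq_same]
    exact rotate_eq k.simple k.conj.simple _ _ _
  · have h' : k.conj ≠ l.conj := fun e => h (by rw [← k.conj_conj, e, l.conj_conj])
    rw [DFinsupp.single_eq_of_ne (Ne.symm h), DFinsupp.single_eq_of_ne (Ne.symm h')]
    simp [rotate, dag_zero]

theorem exists_irr_decomposition (z : C) : ∃ (n : ℕ) (x : Fin n → Irr C)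
    (V : ∀ i, (x i).rep ⟶ z), ∑ i, dag (V i) ≫ V i = 𝟙 z := by
  obtain ⟨n, s, a, hs, -, -, hsum⟩ := RigidCStarTensorCat.semisimple z
  choose g hg1 hg2 using fun i => exists_unitary_of_iso (Irr.mk (s i) (hs i)).simple (hs i)
    (Irr.rep_mk (s i) (hs i)).some
  refine ⟨n, fun i => Irr.mk (s i) (hs i), fun i => g i ≫ a i, ?_⟩
  rw [← hsum]
  refine Finset.sum_congr rfl fun i _ => ?_
  rw [CStarCat.dag_comp, Category.assoc, reassoc_of% (hg2 i)]

/-! ### Elements of the fusion algebra as traces -/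

/-- The element of `A_{𝟙,𝟙}` defined by an endomorphism of `z`. -/
noncomputable def tubeTrace (z : C) (h : z ⟶ z) : Tube (𝟙_ C) (𝟙_ C) :=
  tubePsi z ((ρ_ z).hom ≫ h ≫ (λ_ z).inv)

theorem tubeTrace_comp_comm {z z' : C} (f : z ⟶ z') (g : z' ⟶ z) :
    tubeTrace z (f ≫ g) = tubeTrace z' (g ≫ f) := by
  have h := tubePsi_cyclic f ((ρ_ z').hom ≫ g ≫ (λ_ z).inv)
  simpa [tubeTrace] using h

theorem tubeTrace_smul (z : C) (c : ℂ) (h : z ⟶ z) :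
    tubeTrace z (c • h) = c • tubeTrace z h := by
  simp only [tubeTrace, ← tubePsi_smul, Linear.smul_comp, Linear.comp_smul]

theorem tubeTrace_id_congr {z z' : C} (i : z ≅ z') : tubeTrace z (𝟙 z) = tubeTrace z' (𝟙 z') := by
  rw [← i.hom_inv_id, tubeTrace_comp_comm, i.inv_hom_id]

theorem fusionToTube_single (w : Irr C) : fusionToTube (Finsupp.single w 1) =
    tubeTrace w.rep (𝟙 w.rep) := by
  rw [fusionToTube, Finsupp.sum_single_index, tubeTrace, tubePsi_rep]
  · simp
  · simp

/-! ### The four products in the square of the gradient -/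

section Products

variable {U x X Y : C}

/-- The endomorphism of `U ⊗ U` being traced factors through `𝟙`, and cyclicity moves the trace
there; `e` removes the remaining copies of `j`. -/
theorem tubeMulHom_unitHom_unitHomStar (j : 𝟙_ C ⟶ U) (h1 : j ≫ dag j = 𝟙 _) (r : x ⟶ 𝟙_ C) :
    tubeMulHom U U (unitHom j r) (unitHomStar j r) = tubeTrace (𝟙_ C) (dag r ≫ r) := by
  have h : tubeMulHom U U (unitHom j r) (unitHomStar j r) = tubeTrace (U ⊗ U)
      ((U ◁ dag j ≫ (ρ_ U).hom ≫ dag j) ≫ ((dag r ≫ r) ≫ j ≫ (λ_ U).inv ≫ j ▷ U)) := by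
    rw [tubeMulHom, tubeTrace]
    congr 1
    simp only [unitHom, unitHomStar]
    calc _ = 𝟙 _ ⊗≫ U ◁ dag j ⊗≫ U ◁ dag r ⊗≫ (U ◁ x ◁ j ≫ dag j ▷ (x ⊗ U)) ⊗≫ r ▷ U ⊗≫
          j ▷ U ⊗≫ 𝟙 _ := by monoidal
      _ = 𝟙 _ ⊗≫ U ◁ dag j ⊗≫ U ◁ dag r ⊗≫ (dag j ▷ (x ⊗ 𝟙_ C) ≫ 𝟙_ C ◁ x ◁ j) ⊗≫ r ▷ U ⊗≫
          j ▷ U ⊗≫ 𝟙 _ := by rw [whisker_exchange]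
      _ = 𝟙 _ ⊗≫ U ◁ dag j ⊗≫ (U ◁ dag r ≫ dag j ▷ x) ⊗≫ (x ◁ j ≫ r ▷ U) ⊗≫
          j ▷ U ⊗≫ 𝟙 _ := by monoidal
      _ = 𝟙 _ ⊗≫ U ◁ dag j ⊗≫ (dag j ▷ 𝟙_ C ≫ 𝟙_ C ◁ dag r) ⊗≫ (r ▷ 𝟙_ C ≫ 𝟙_ C ◁ j) ⊗≫
          j ▷ U ⊗≫ 𝟙 _ := by rw [whisker_exchange, whisker_exchange]
      _ = _ := by monoidal
  have e : (j ≫ (λ_ U).inv ≫ j ▷ U) ≫ U ◁ dag j ≫ (ρ_ U).hom ≫ dag j = 𝟙 _ := by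
    simp only [Category.assoc]
    rw [← whisker_exchange_assoc]
    simp [h1, ← unitors_equal]
  rw [h, tubeTrace_comp_comm, Category.assoc, e, Category.comp_id]

/-- The product is the trace of `R̄ R̄*` on `X ⊗ Y`, which cyclicity closes to the loop `R̄* R̄` on
the unit. -/
theorem tubeMulHom_capHom_capHomStar (s : ConjSolution X Y) :
    tubeMulHom X Y (capHom s) (capHomStar s) = tubeTrace (𝟙_ C) (s.Rbar ≫ dag s.Rbar) := by
  rw [tubeTrace_comp_comm, tubeMulHom, tubeTrace]
  congr 1
  simp only [capHom, capHomStar]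
  calc _ = 𝟙 _ ⊗≫ ((X ⊗ Y) ◁ s.Rbar ≫ dag s.Rbar ▷ (X ⊗ Y)) ⊗≫ 𝟙 _ := by monoidal
    _ = 𝟙 _ ⊗≫ (dag s.Rbar ▷ 𝟙_ C ≫ 𝟙_ C ◁ s.Rbar) ⊗≫ 𝟙 _ := by rw [whisker_exchange]
    _ = _ := by monoidal

/-- A cross term: `R*` against `R̄` is a zigzag on `Y`, and `U ⊗ Y ≅ Y`. -/
theorem tubeMulHom_unitHom_capHomStar (j : 𝟙_ C ⟶ U) (h1 : j ≫ dag j = 𝟙 _)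
    (h2 : dag j ≫ j = 𝟙 U) (s : ConjSolution X Y) :
    tubeMulHom U Y (unitHom j (dag s.R)) (capHomStar s) = tubeTrace Y (𝟙 Y) := by
  rw [tubeTrace_id_congr ((λ_ Y).symm ≪≫ whiskerRightIso ⟨j, dag j, h1, h2⟩ Y), tubeMulHom,
    tubeTrace]
  congr 1
  simp only [unitHom, capHomStar]
  calc _ = 𝟙 _ ⊗≫ (U ◁ (Y ◁ s.Rbar) ≫ dag j ▷ (Y ⊗ (X ⊗ Y))) ⊗≫ dag s.R ▷ Y ⊗≫ j ▷ Y ⊗≫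
        𝟙 _ := by monoidal
    _ = 𝟙 _ ⊗≫ (dag j ▷ (Y ⊗ 𝟙_ C) ≫ 𝟙_ C ◁ (Y ◁ s.Rbar)) ⊗≫ dag s.R ▷ Y ⊗≫ j ▷ Y ⊗≫
        𝟙 _ := by rw [whisker_exchange]
    _ = 𝟙 _ ⊗≫ dag j ▷ Y ⊗≫ ((ρ_ Y).inv ≫ Y ◁ s.Rbar ≫ (α_ Y X Y).inv ≫ dag s.R ▷ Y ≫
        (λ_ Y).hom) ⊗≫ j ▷ Y ⊗≫ 𝟙 _ := by monoidal
    _ = 𝟙 _ ⊗≫ (dag j ≫ j) ▷ Y ⊗≫ 𝟙 _ := by rw [ConjSolution.dag_conj_eq s]; monoidal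
    _ = _ := by rw [h2]; monoidal

theorem tubeMulHom_capHom_unitHomStar (j : 𝟙_ C ⟶ U) (h1 : j ≫ dag j = 𝟙 _)
    (h2 : dag j ≫ j = 𝟙 U) (s : ConjSolution X Y) :
    tubeMulHom X U (capHom s) (unitHomStar j (dag s.R)) = tubeTrace X (𝟙 X) := by
  rw [tubeTrace_id_congr ((ρ_ X).symm ≪≫ whiskerLeftIso X ⟨j, dag j, h1, h2⟩), tubeMulHom,
    tubeTrace]
  congr 1
  simp only [unitHomStar, capHom, CStarCat.dag_dag]
  calc _ = 𝟙 _ ⊗≫ X ◁ dag j ⊗≫ X ◁ s.R ⊗≫ ((X ⊗ Y) ◁ (X ◁ j) ≫ dag s.Rbar ▷ (X ⊗ U)) ⊗≫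
        𝟙 _ := by monoidal
    _ = 𝟙 _ ⊗≫ X ◁ dag j ⊗≫ X ◁ s.R ⊗≫ (dag s.Rbar ▷ (X ⊗ 𝟙_ C) ≫ 𝟙_ C ◁ (X ◁ j)) ⊗≫
        𝟙 _ := by rw [whisker_exchange]
    _ = 𝟙 _ ⊗≫ X ◁ dag j ⊗≫ ((ρ_ X).inv ≫ X ◁ s.R ≫ (α_ X Y X).inv ≫ dag s.Rbar ▷ X ≫
        (λ_ X).hom) ⊗≫ X ◁ j ⊗≫ 𝟙 _ := by monoidal
    _ = 𝟙 _ ⊗≫ X ◁ (dag j ≫ j) ⊗≫ 𝟙 _ := by rw [ConjSolution.dag_conj_eq' s]; monoidal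
    _ = _ := by rw [h2]; monoidal

end Products

/-! ### The tube cone is a convex cone -/

set_option linter.unusedSectionVars false in
theorem fusionToTube_add (a b : FusionAlg C) :
    fusionToTube (a + b) = fusionToTube a + fusionToTube b := by
  classical
  refine Finsupp.sum_add_index' (fun w => ?_) fun w c d => ?_
  · rw [zero_smul, DFinsupp.single_zero]
  · rw [add_smul, DFinsupp.single_add]

set_option linter.unusedSectionVars false in
theorem fusionToTube_smul (c : ℂ) (a : FusionAlg C) :
    fusionToTube (c • a) = c • fusionToTube a := by
  classical
  rw [fusionToTube, fusionToTube, Finsupp.sum_smul_index' fun w => by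
    rw [zero_smul, DFinsupp.single_zero], Finsupp.smul_sum]
  simp only [smul_assoc, DFinsupp.single_smul]

theorem mem_tubeCone_of_fintype {ι : Type*} [Fintype ι] {b : FusionAlg C} (x : ι → Irr C)
    (a : ∀ i, Tube (x i).rep (𝟙_ C)) (h : fusionToTube b = ∑ i, tubeMul (a i) (tubeStar (a i))) :
    b ∈ tubeCone C := by
  let e := (Fintype.equivFin ι).symm
  exact ⟨Fintype.card ι, x ∘ e, fun i => a (e i),
    h.trans (e.sum_comp fun i => tubeMul (a i) (tubeStar (a i))).symm⟩

theorem tubeCone_add_mem {a b : FusionAlg C} (ha : a ∈ tubeCone C) (hb : b ∈ tubeCone C) :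
    a + b ∈ tubeCone C := by
  obtain ⟨n, x, p, hp⟩ := ha
  obtain ⟨m, y, q, hq⟩ := hb
  refine mem_tubeCone_of_fintype (ι := Fin n ⊕ Fin m) (Sum.elim x y)
    (fun i => match i with
      | .inl i => p i
      | .inr i => q i) ?_
  rw [fusionToTube_add, hp, hq, Fintype.sum_sum_type]
  rfl

theorem zero_mem_tubeCone : (0 : FusionAlg C) ∈ tubeCone C :=
  ⟨0, Fin.elim0, fun i => i.elim0, by simpa using fusionToTube_smul 0 (0 : FusionAlg C)⟩

theorem tubeCone_sum_mem {ι : Type*} (s : Finset ι) (f : ι → FusionAlg C)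
    (h : ∀ i ∈ s, f i ∈ tubeCone C) : ∑ i ∈ s, f i ∈ tubeCone C :=
  Finset.sum_induction f (· ∈ tubeCone C) (fun _ _ => tubeCone_add_mem) zero_mem_tubeCone h

theorem tubeMul_smul_left {i s j : C} (c : ℂ) (a : Tube s j) (b : Tube i s) :
    tubeMul (c • a) b = c • tubeMul a b := by
  classical
  rcases eq_or_ne c 0 with rfl | hc
  · simp [tubeMul_eq_sum, DFinsupp.sum]
  · have h : (c • a).support = a.support := by ext; simp [hc]
    simp only [tubeMul_eq_sum, DFinsupp.sum, h, DFinsupp.smul_apply, tubeMulHom_smul_left,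
      Finset.smul_sum]

theorem tubeMul_smul_right {i s j : C} (c : ℂ) (a : Tube s j) (b : Tube i s) :
    tubeMul a (c • b) = c • tubeMul a b := by
  classical
  rcases eq_or_ne c 0 with rfl | hc
  · simp [tubeMul_eq_sum, DFinsupp.sum]
  · have h : (c • b).support = b.support := by ext; simp [hc]
    simp only [tubeMul_eq_sum, DFinsupp.sum, h, DFinsupp.smul_apply, tubeMulHom_smul_right,
      Finset.smul_sum]

theorem tubeStar_smul {x y : C} (c : ℂ) (a : Tube x y) :
    tubeStar (c • a) = conj c • tubeStar a := by
  refine DFinsupp.ext fun k => ?_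
  simp only [DFinsupp.smul_apply, tubeStar_apply, CStarCat.dag_smul,
    MonoidalLinear.whiskerLeft_smul, MonoidalLinear.smul_whiskerRight, Linear.smul_comp,
    Linear.comp_smul]

theorem tubeCone_smul_mem {r : ℝ} (hr : 0 ≤ r) {b : FusionAlg C} (hb : b ∈ tubeCone C) :
    (r : ℂ) • b ∈ tubeCone C := by
  obtain ⟨n, x, a, ha⟩ := hb
  -- The involution is conjugate linear and `√r` is real, so each square scales by `r`.
  refine ⟨n, x, fun i => (Real.sqrt r : ℂ) • a i, ?_⟩
  have h : (Real.sqrt r : ℂ) * (Real.sqrt r : ℂ) = r := by exact_mod_cast Real.mul_self_sqrt hr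
  rw [fusionToTube_smul, ha, Finset.smul_sum]
  refine Finset.sum_congr rfl fun i _ => ?_
  rw [tubeStar_smul, tubeMul_smul_left, tubeMul_smul_right, Complex.conj_ofReal, smul_smul, h]

/-! ### The gradient squared and the Laplacian -/

theorem Irr.Rbar_comp_dag (w : Irr C) :
    w.std.Rbar ≫ dag w.std.Rbar = (w.dim : ℂ) • 𝟙 (𝟙_ C) := by
  have h := w.std_isStandard (𝟙 _)
  rw [whiskerLeft_id, id_whiskerRight, Category.id_comp, Category.id_comp, w.dim_spec.2] at h
  exact h.symm

open Classical in
theorem tubeMul_tubeStar_sub {x : C} {k w k' w' : Irr C} (s : ConjSolution k'.rep k.rep)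
    (t : ConjSolution w'.rep w.rep) (p : k.rep ⊗ x ⟶ 𝟙_ C ⊗ k.rep)
    (q : w.rep ⊗ x ⟶ 𝟙_ C ⊗ w.rep) :
    tubeMul (DFinsupp.single k p + (-1 : ℂ) • DFinsupp.single w q)
        (tubeStar (DFinsupp.single k p + (-1 : ℂ) • DFinsupp.single w q)) =
      tubeMulHom k.rep k'.rep p (rotate s p) - tubeMulHom k.rep w'.rep p (rotate t q) -
        tubeMulHom w.rep k'.rep q (rotate s p) + tubeMulHom w.rep w'.rep q (rotate t q) := by
  rw [tubeStar_add, tubeStar_smul, tubeStar_single s, tubeStar_single t]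
  simp only [tubeMul_add_left, tubeMul_add_right, tubeMul_smul_left, tubeMul_smul_right,
    tubeMul_single, map_neg, map_one]
  module

/-- `2 d(w) 𝟙 - w - w̄ = a a*` for `a = R* - (R̄* ⊗ 1)`, with `R* ∈ C(w̄ ⊗ w, 𝟙)` in degree `𝟙` and
`R̄* ⊗ 1 ∈ C(w ⊗ (w̄ ⊗ w), w)` in degree `w`; the object `w̄ ⊗ w` is then decomposed into simple
objects. -/
theorem two_dim_sub_mem_tubeCone (w : Irr C) :
    (2 * w.dim : ℂ) • Finsupp.single (Irr.unit C) 1 - Finsupp.single w 1 -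
      Finsupp.single w.conj 1 ∈ tubeCone C := by
  classical
  obtain ⟨k, hk⟩ : ∃ k, k = Irr.unit C := ⟨_, rfl⟩
  -- The chosen representative of the unit class is only isomorphic to `𝟙`; `j` is a unitary
  -- identification.
  obtain ⟨j, h1, h2⟩ : ∃ j : 𝟙_ C ⟶ k.rep, j ≫ dag j = 𝟙 _ ∧ dag j ≫ j = 𝟙 _ :=
    exists_unitary_of_iso RigidCStarTensorCat.simple_unit k.simple
      (hk ▸ (Irr.rep_mk (𝟙_ C) RigidCStarTensorCat.simple_unit).some.symm)
  rw [← hk]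
  obtain ⟨n, x, V, hV⟩ := exists_irr_decomposition (w.conj.rep ⊗ w.rep)
  refine ⟨n, x, fun i =>
    (DFinsupp.single k (k.rep ◁ V i ≫ unitHom j (dag w.std.R)) : Tube (x i).rep (𝟙_ C)) +
      (-1 : ℂ) • (DFinsupp.single w (w.rep ◁ V i ≫ capHom w.std) : Tube (x i).rep (𝟙_ C)), ?_⟩
  -- In each of the four products the sum over `i` collapses by `∑ Vᵢ Vᵢ* = 1`, leaving the terms
  -- for the colour `w̄ ⊗ w`.
  simp only [tubeMul_tubeStar_sub (ConjSolution.ofUnitary j h1 h2) (ConjSolution.symm w.std),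
    rotate_whiskerLeft_comp, rotate_unitHom, rotate_capHom, Finset.sum_add_distrib,
    Finset.sum_sub_distrib, sum_tubeMulHom V hV]
  rw [tubeMulHom_unitHom_unitHomStar j h1, tubeMulHom_capHom_capHomStar,
    tubeMulHom_unitHom_capHomStar j h1 h2, tubeMulHom_capHom_unitHomStar j h1 h2,
    CStarCat.dag_dag, w.dim_spec.2, w.Rbar_comp_dag, tubeTrace_smul,
    tubeTrace_id_congr (⟨j, dag j, h1, h2⟩ : 𝟙_ C ≅ k.rep)]
  simp only [sub_eq_add_neg, ← neg_one_smul ℂ (Finsupp.single _ _), fusionToTube_add,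
    fusionToTube_smul, fusionToTube_single]
  module

theorem kappa_pos {S : Finset (Irr C)} (hS : S.Nonempty) {ν : Irr C → ℝ}
    (hpos : ∀ w ∈ S, 0 < ν w) : 0 < kappa S ν :=
  Finset.sum_pos (fun w hw => mul_pos (hpos w hw) w.dim_spec.1) hS

theorem IsSymmetricSet.sum_conj {S : Finset (Irr C)} (hsym : IsSymmetricSet S) {M : Type*}
    [AddCommMonoid M] (f : Irr C → M) : ∑ w ∈ S, f w.conj = ∑ w ∈ S, f w :=
  Finset.sum_bij' (fun w _ => w.conj) (fun w _ => w.conj) (fun w hw => (hsym w).1 hw)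
    (fun w hw => (hsym w).1 hw) (fun w _ => w.conj_conj) (fun w _ => w.conj_conj)
    (fun _ _ => rfl)

/-- Reindexing by conjugation shows that the `w` and `w̄` terms have equal sums, and the unit terms
add up to `2κ`; hence the factor `1/(2κ)`. -/
theorem laplacian_eq_sum {S : Finset (Irr C)} (hsym : IsSymmetricSet S) {ν : Irr C → ℝ}
    (hν : ∀ w ∈ S, ν w.conj = ν w) (hκ : kappa S ν ≠ 0) :
    laplacian S ν = (((2 * kappa S ν)⁻¹ : ℝ) : ℂ) • ∑ w ∈ S, (ν w : ℂ) •
      ((2 * w.dim : ℂ) • Finsupp.single (Irr.unit C) (1 : ℂ) - Finsupp.single w 1 -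
        Finsupp.single w.conj 1) := by
  have hs : ∀ w : Irr C, Finsupp.single w (ν w : ℂ) = (ν w : ℂ) • Finsupp.single w (1 : ℂ) :=
    fun w => by rw [Finsupp.smul_single, smul_eq_mul, mul_one]
  have hc : ∑ w ∈ S, (ν w : ℂ) • Finsupp.single w.conj (1 : ℂ) =
      ∑ w ∈ S, (ν w : ℂ) • Finsupp.single w (1 : ℂ) := by
    rw [← hsym.sum_conj fun w => (ν w : ℂ) • Finsupp.single w (1 : ℂ)]
    exact Finset.sum_congr rfl fun w hw => by rw [hν w hw]
  have hd : ∑ w ∈ S, (ν w : ℂ) * (2 * w.dim) = 2 * (kappa S ν : ℂ) := by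
    rw [kappa, Complex.ofReal_sum, Finset.mul_sum]
    exact Finset.sum_congr rfl fun w _ => by push_cast; ring
  have hκ' : (kappa S ν : ℂ) ≠ 0 := by exact_mod_cast hκ
  have h1 : ((2 * kappa S ν)⁻¹ : ℂ) * (2 * kappa S ν) = 1 :=
    inv_mul_cancel₀ (mul_ne_zero two_ne_zero hκ')
  have h2 : (kappa S ν : ℂ)⁻¹ = 2 * (2 * kappa S ν : ℂ)⁻¹ := by field_simp
  simp only [laplacian, hs, smul_sub, Finset.sum_sub_distrib, hc]
  simp only [smul_smul, ← Finset.sum_smul, hd]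
  push_cast
  rw [h1, h2]
  module

end CStarTensor

theorem mainTheorem4 {C : Type u} [Category.{v} C] [Preadditive C] [Linear ℂ C]
    [MonoidalCategory C] [MonoidalPreadditive C] [MonoidalLinear ℂ C] [CStarCat C]
    [RigidCStarTensorCat C]
    (S : Finset (CStarTensor.Irr C)) (hsym : CStarTensor.IsSymmetricSet S)
    (hgen : CStarTensor.IsGeneratingSet S)
    (ν : CStarTensor.Irr C → ℝ) (hpos : ∀ w ∈ S, 0 < ν w) (hν : ∀ w ∈ S, ν w.conj = ν w) :
    CStarTensor.laplacian S ν ∈ CStarTensor.tubeCone C := by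
  -- Generation of the unit class provides an element of `S`, so `κ > 0`.
  obtain ⟨s, -, hs, -⟩ := hgen (CStarTensor.Irr.unit C)
  have hκ := CStarTensor.kappa_pos ⟨s, hs⟩ hpos
  rw [CStarTensor.laplacian_eq_sum hsym hν hκ.ne']
  refine CStarTensor.tubeCone_smul_mem (by positivity) (CStarTensor.tubeCone_sum_mem S _ ?_)
  exact fun w hw =>
    CStarTensor.tubeCone_smul_mem (hpos w hw).le (CStarTensor.two_dim_sub_mem_tubeCone w)
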